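/- Let $K$ be a Henselian valued field, with nontrivial valuation ring $\mathcal{O}_K$. For every finite field extension $L$ of $K$ let $\mathcal{O}_L$ denote the unique valuation ring of $L$ with $\mathcal{O}_L\cap K=\mathcal{O}_K$. Let $\mathcal{L}_{\mathrm{ring}}=(+,-,\cdot,0,1)$ be the language of rings, and for an $\mathcal{L}_{\mathrm{ring}}$-formula $\varphi(x)$ in one free variable (without parameters) write $\varphi(L)$ for the set of elements of $L$ that satisfy $\varphi$ in $L$. Then there is no existential $\mathcal{L}_{\mathrm{ring}}$-formula $\psi(x)$ such that $\mathcal{O}_L=\psi(L)$ for all finite extensions $L$ of $K$, and there is no universal $\mathcal{L}_{\mathrm{ring}}$-formula $\eta(x)$ such that $\mathcal{O}_L=\eta(L)$ for all finite extensions $L$ of $K$. -/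

import Mathlib

universe u

open FirstOrder

/-- For a formula `φ` of the language of rings in one free variable and a ring `R`, the set
`φ(R)` of the elements of `R` that satisfy `φ`. No parameters are allowed in `φ`. -/
def definedSet (φ : Language.ring.Formula (Fin 1)) (R : Type*) [Ring R] : Set R :=
  letI := Ring.compatibleRingOfRing R
  {x | φ.Realize (fun _ => x)}

/-- The valuation ring `B` of an extension field `L` of `K` prolongs (lies over) the valuation ring
`O` of `K`: `B ∩ K = O`. If `O` is Henselian and `L` is algebraic over `K`, there is exactly one
such `B`; it is the valuation ring of `L`. -/
def Prolongs {K L : Type*} [Field K] [Field L] [Algebra K L]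
    (O : ValuationSubring K) (B : ValuationSubring L) : Prop :=
  B.comap (algebraMap K L) = O

/-- The formula `φ` defines the valuation ring in every finite extension of the valued field
`(K, O)`: for every finite extension `L` of `K`, the set `φ(L)` is the valuation ring of `L`. -/
def DefinesValuationRings {K : Type u} [Field K] (O : ValuationSubring K)
    (φ : Language.ring.Formula (Fin 1)) : Prop :=
  ∀ (L : Type u) [Field L] [Algebra K L] [FiniteDimensional K L],
    ∃ B : ValuationSubring L, Prolongs O B ∧ (B : Set L) = definedSet φ L

open FirstOrder.Language FirstOrder.Ring Filter

/-- An injective ring homomorphism is an embedding of structures for the language of rings. -/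
def ringEmbedding {R S : Type*} [Ring R] [Ring S] [CompatibleRing R] [CompatibleRing S]
    (f : R →+* S) (hf : Function.Injective f) : R ↪[Language.ring] S where
  toFun := f
  inj' := hf
  map_fun' {n} g x := by cases g <;> simp
  map_rel' {n} r := by cases r

/-- Finitely many elements of an algebraic extension lie in a finite subextension. -/
theorem exists_finiteDimensional_lift {K A : Type*} [Field K] [Field A] [Algebra K A]
    [Algebra.IsAlgebraic K A] {α β : Type*} [Finite α] [Finite β] (v : α → A) (w : β → A) :
    ∃ F : IntermediateField K A, FiniteDimensional K F ∧
      ∃ (v' : α → F) (w' : β → F), F.val ∘ v' = v ∧ F.val ∘ w' = w := by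
  have hs : (Set.range v ∪ Set.range w).Finite := (Set.finite_range v).union (Set.finite_range w)
  have := hs.to_subtype
  refine ⟨IntermediateField.adjoin K (Set.range v ∪ Set.range w),
    IntermediateField.finiteDimensional_adjoin fun x _ => Algebra.IsIntegral.isIntegral x,
    fun a => ⟨v a, IntermediateField.subset_adjoin _ _ (.inl ⟨a, rfl⟩)⟩,
    fun b => ⟨w b, IntermediateField.subset_adjoin _ _ (.inr ⟨b, rfl⟩)⟩, rfl, rfl⟩

section Descent

variable {K A : Type*} [Field K] [Field A] [Algebra K A] [Algebra.IsAlgebraic K A]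

attribute [local instance] compatibleRingOfRing

theorem FirstOrder.Language.BoundedFormula.IsExistential.exists_finiteDimensional_realize
    {α : Type*} [Finite α] {n : ℕ} {φ : Language.ring.BoundedFormula α n} (hφ : φ.IsExistential)
    (v : α → A) (xs : Fin n → A) (h : φ.Realize v xs) :
    ∃ F : IntermediateField K A, FiniteDimensional K F ∧
      ∃ (v' : α → F) (xs' : Fin n → F), F.val ∘ v' = v ∧ F.val ∘ xs' = xs ∧
        φ.Realize v' xs' := by
  induction hφ with
  | of_isQF hφ =>
    obtain ⟨F, hF, v', xs', rfl, rfl⟩ := exists_finiteDimensional_lift (K := K) v xs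
    exact ⟨F, hF, v', xs', rfl, rfl,
      (hφ.realize_embedding (ringEmbedding (algebraMap F A) (algebraMap F A).injective)).1 h⟩
  | ex _ ih =>
    obtain ⟨a, ha⟩ := BoundedFormula.realize_ex.1 h
    obtain ⟨F, hF, v', xs', hv, hxs, hr⟩ := ih _ ha
    refine ⟨F, hF, v', Fin.init xs', hv, ?_, BoundedFormula.realize_ex.2 ⟨xs' (Fin.last _), ?_⟩⟩
    · ext i
      simpa [Fin.init] using congrFun hxs i.castSucc
    · rwa [Fin.snoc_init_self]

theorem FirstOrder.Language.BoundedFormula.IsUniversal.exists_finiteDimensional_not_realize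
    {α : Type*} [Finite α] {n : ℕ} {φ : Language.ring.BoundedFormula α n} (hφ : φ.IsUniversal)
    (v : α → A) (xs : Fin n → A) (h : ¬ φ.Realize v xs) :
    ∃ F : IntermediateField K A, FiniteDimensional K F ∧
      ∃ (v' : α → F) (xs' : Fin n → F), F.val ∘ v' = v ∧ F.val ∘ xs' = xs ∧
        ¬ φ.Realize v' xs' := by
  induction hφ with
  | of_isQF hφ =>
    obtain ⟨F, hF, v', xs', rfl, rfl⟩ := exists_finiteDimensional_lift (K := K) v xs
    exact ⟨F, hF, v', xs', rfl, rfl, fun h' => h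
      ((hφ.realize_embedding (ringEmbedding (algebraMap F A) (algebraMap F A).injective)).2 h')⟩
  | all _ ih =>
    obtain ⟨a, ha⟩ := not_forall.1 (mt BoundedFormula.realize_all.2 h)
    obtain ⟨F, hF, v', xs', hv, hxs, hr⟩ := ih _ ha
    refine ⟨F, hF, v', Fin.init xs', hv, ?_, fun h' => hr ?_⟩
    · ext i
      simpa [Fin.init] using congrFun hxs i.castSucc
    · simpa only [Fin.snoc_init_self] using BoundedFormula.realize_all.1 h' (xs' (Fin.last _))

end Descent

/-- Any two transcendental elements of an algebraically closed field are conjugate. -/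
theorem exists_ringEquiv_apply_eq_of_transcendental {k M : Type*} [Field k] [Field M] [Algebra k M]
    [IsAlgClosed M] {s t : M} (hs : Transcendental k s) (ht : Transcendental k t) :
    ∃ σ : M ≃+* M, σ s = t := by
  classical
  obtain ⟨B, hsB, hB⟩ := exists_isTranscendenceBasis_superset (R := k) (s := {s})
    (algebraicIndependent_unique_type_iff.2 hs)
  obtain ⟨C, htC, hC⟩ := exists_isTranscendenceBasis_superset (R := k) (s := {t})
    (algebraicIndependent_unique_type_iff.2 ht)
  let b : B := ⟨s, hsB rfl⟩
  obtain ⟨e₀⟩ := Cardinal.eq.1 (hB.cardinalMk_eq hC)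
  let e : B ≃ C := e₀.setValue b ⟨t, htC rfl⟩
  have he : e b = ⟨t, htC rfl⟩ := Equiv.setValue_eq _ _ _
  have hC' : IsTranscendenceBasis k ((↑) ∘ e : B → M) := hC.comp_equiv e
  let _ := IsAlgClosed.isAlgClosure_of_transcendence_basis _ hB
  let _ := IsAlgClosed.isAlgClosure_of_transcendence_basis _ hC'
  let f := hB.1.aevalEquiv.symm.trans hC'.1.aevalEquiv
  refine ⟨IsAlgClosure.equivOfEquiv M M f.toRingEquiv, ?_⟩
  have h := IsAlgClosure.equivOfEquiv_algebraMap M M f.toRingEquiv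
    (hB.1.aevalEquiv (MvPolynomial.X b))
  have h₁ : algebraMap _ M (hB.1.aevalEquiv (MvPolynomial.X b)) = s := by simp [b]
  have h₂ : algebraMap _ M (f.toRingEquiv (hB.1.aevalEquiv (MvPolynomial.X b))) = t := by
    simp [f, he]
  rw [← h₁, h, h₂]

/-- A subset of an algebraically closed field that is definable without parameters is finite or
cofinite. -/
theorem finite_or_finite_compl_setOf_realize {A : Type*} [Field A] [IsAlgClosed A]
    [CompatibleRing A] (φ : Language.ring.Formula (Fin 1)) :
    {x : A | φ.Realize fun _ => x}.Finite ∨ {x : A | φ.Realize fun _ => x}ᶜ.Finite := by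
  by_contra! ⟨hinf, hinf'⟩
  let x := Set.Infinite.natEmbedding _ hinf
  let y := Set.Infinite.natEmbedding _ hinf'
  let U : Ultrafilter ℕ := hyperfilter ℕ
  let M := (U : Filter ℕ).Product fun _ => A
  let germ : (ℕ → A) → M := fun z => (z : M)
  obtain ⟨p, hp⟩ := CharP.exists A
  have hM : (Theory.ACF p).Model M := (Theory.model_iff _).2 fun θ hθ =>
    (Ultraproduct.sentence_realize θ).2 (.of_forall fun _ => Theory.realize_sentence_of_mem _ hθ)
  let _ := Field.fieldOfModelACF p M
  have := Field.modelField_of_modelACF p M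
  let _ := Field.compatibleRingOfModelField M
  have := Field.isAlgClosed_of_model_ACF p M
  have germ_fun {n : ℕ} (f : Language.ring.Functions n) (z : Fin n → A) :
      germ (fun _ => Structure.funMap f z) = Structure.funMap f fun i => germ fun _ => z i :=
    (Ultraproduct.funMap_cast f fun i _ => z i).symm
  let diag : A →+* M :=
    { toFun a := germ fun _ => a
      map_zero' := by simpa using germ_fun zeroFunc ![]
      map_one' := by simpa using germ_fun oneFunc ![]
      map_add' a b := by simpa using germ_fun addFunc ![a, b]
      map_mul' a b := by simpa using germ_fun mulFunc ![a, b] }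
  let _ : Algebra A M := diag.toAlgebra
  have germ_transcendental (z : ℕ → A) (hz : Function.Injective z) :
      Transcendental A (germ z) := fun halg => by
    obtain ⟨a, ha⟩ : germ z ∈ (algebraMap A M).range :=
      halg.isIntegral.mem_range_algebraMap_of_minpoly_splits
        ((IsAlgClosed.splits (minpoly A (germ z))).map _)
    have hev : ∀ᶠ n in U, a = z n := Quotient.eq''.1 ha
    have hfin : {n | a = z n}.Finite :=
      Set.Subsingleton.finite fun m hm n hn => hz (hm.symm.trans hn)
    exact notMem_hyperfilter_of_finite hfin hev
  have realize_germ (z : ℕ → A) :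
      (φ.Realize fun _ => germ z) ↔ ∀ᶠ n in U, φ.Realize fun _ => z n :=
    Ultraproduct.realize_formula_cast φ fun _ => z
  obtain ⟨σ, hσ⟩ := exists_ringEquiv_apply_eq_of_transcendental
    (germ_transcendental (fun n => x n) (Subtype.val_injective.comp x.injective))
    (germ_transcendental (fun n => y n) (Subtype.val_injective.comp y.injective))
  have hx := (realize_germ fun n => x n).2 (.of_forall fun n => (x n).2)
  rw [← StrongHomClass.realize_formula (languageEquivEquivRingEquiv.symm σ) φ] at hx
  have hy : φ.Realize fun _ => germ fun n => y n := by
    rw [← hσ]; exact hx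
  obtain ⟨n, hn⟩ := ((realize_germ fun n => y n).1 hy).exists
  exact (y n).2 hn

/-- A nontrivial valuation ring is infinite. -/
theorem ValuationSubring.infinite_of_ne_top {K : Type*} [Field K] {O : ValuationSubring K}
    (hO : O ≠ ⊤) : (O : Set K).Infinite := fun hfin => hO <| by
  have : Finite O := hfin.to_subtype
  have hF : IsField O := Finite.isField_of_domain O
  refine top_unique fun x _ => ?_
  obtain h | h := O.mem_or_inv_mem x
  · exact h
  · obtain rfl | hx := eq_or_ne x 0
    · exact O.zero_mem
    obtain ⟨y, hy⟩ := hF.mul_inv_cancel (a := ⟨x⁻¹, h⟩) (by simpa [Subtype.ext_iff] using hx)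
    have hy' : x⁻¹ * y = 1 := congrArg Subtype.val hy
    rw [← inv_inv x, ← eq_inv_of_mul_eq_one_right hy']
    exact y.2

/-- The complement of a nontrivial valuation ring is infinite. -/
theorem ValuationSubring.infinite_compl_of_ne_top {K : Type*} [Field K] {O : ValuationSubring K}
    (hO : O ≠ ⊤) : (O : Set K)ᶜ.Infinite := by
  obtain ⟨x, hx⟩ : ∃ x, x ∉ O := by
    by_contra! h
    exact hO (top_unique fun x _ => h x)
  refine ((infinite_of_ne_top hO).image (add_right_injective x).injOn).mono ?_
  rintro _ ⟨y, hy, rfl⟩ h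
  exact hx (by simpa using sub_mem h hy)

theorem Prolongs.algebraMap_mem_iff {K L : Type*} [Field K] [Field L] [Algebra K L]
    {O : ValuationSubring K} {B : ValuationSubring L} (h : Prolongs O B) (x : K) :
    algebraMap K L x ∈ B ↔ x ∈ O := by
  rw [← ValuationSubring.mem_comap, h]

/-- A parameter-free definable set of an algebraically closed field does not cut out a nontrivial
valuation ring of a subfield. -/
theorem not_forall_algebraMap_mem_definedSet_iff {K A : Type*} [Field K] [Field A] [Algebra K A]
    [IsAlgClosed A] {O : ValuationSubring K} (hO : O ≠ ⊤) (φ : Language.ring.Formula (Fin 1)) :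
    ¬ ∀ x : K, algebraMap K A x ∈ definedSet φ A ↔ x ∈ O := fun h => by
  let _ := compatibleRingOfRing A
  have hinj (s : Set K) := (algebraMap K A).injective.injOn (s := s)
  obtain hfin | hfin := finite_or_finite_compl_setOf_realize (A := A) φ
  · exact ValuationSubring.infinite_of_ne_top hO
      ((hfin.preimage (hinj _)).subset fun x hx => (h x).2 hx)
  · exact ValuationSubring.infinite_compl_of_ne_top hO
      ((hfin.preimage (hinj _)).subset fun x hx => fun hx' => hx ((h x).1 hx'))

theorem DefinesValuationRings.algebraMap_mem_definedSet_iff {K : Type u} [Field K]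
    {O : ValuationSubring K} {φ : Language.ring.Formula (Fin 1)} (h : DefinesValuationRings O φ)
    (L : Type u) [Field L] [Algebra K L] [FiniteDimensional K L] (x : K) :
    algebraMap K L x ∈ definedSet φ L ↔ x ∈ O := by
  obtain ⟨B, hB, hφ⟩ := h L
  rw [← hφ]
  exact hB.algebraMap_mem_iff x

/-- Existential formulas are preserved under extensions. -/
theorem FirstOrder.Language.BoundedFormula.IsExistential.map_mem_definedSet {R S : Type*} [Ring R]
    [Ring S] {φ : Language.ring.Formula (Fin 1)} (hφ : φ.IsExistential) {f : R →+* S}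
    (hf : Function.Injective f) {x : R} (hx : x ∈ definedSet φ R) : f x ∈ definedSet φ S := by
  let _ := compatibleRingOfRing R
  let _ := compatibleRingOfRing S
  have := hφ.realize_embedding (ringEmbedding f hf) hx
  rwa [Subsingleton.elim (_ ∘ default) default] at this

/-- Universal formulas are reflected by extensions. -/
theorem FirstOrder.Language.BoundedFormula.IsUniversal.mem_definedSet_of_map {R S : Type*} [Ring R]
    [Ring S] {φ : Language.ring.Formula (Fin 1)} (hφ : φ.IsUniversal) {f : R →+* S}
    (hf : Function.Injective f) {x : R} (hx : f x ∈ definedSet φ S) : x ∈ definedSet φ R := by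
  let _ := compatibleRingOfRing R
  let _ := compatibleRingOfRing S
  refine hφ.realize_embedding (ringEmbedding f hf) ?_
  rwa [Subsingleton.elim (_ ∘ default) default]

theorem FirstOrder.Language.BoundedFormula.IsExistential.not_definesValuationRings {K : Type u}
    [Field K] {O : ValuationSubring K} (hO : O ≠ ⊤) {φ : Language.ring.Formula (Fin 1)}
    (hφ : φ.IsExistential) : ¬ DefinesValuationRings O φ := fun h => by
  refine not_forall_algebraMap_mem_definedSet_iff (A := AlgebraicClosure K) hO φ fun x =>
    ⟨fun hx => ?_, fun hx => hφ.map_mem_definedSet (algebraMap K (AlgebraicClosure K)).injective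
      ((h.algebraMap_mem_definedSet_iff K x).2 hx)⟩
  obtain ⟨F, _, v, xs, hv, -, hr⟩ := hφ.exists_finiteDimensional_realize (K := K) _ _ hx
  refine (h.algebraMap_mem_definedSet_iff F x).1 ?_
  have hv' : v = fun _ => algebraMap K F x := funext fun i => Subtype.ext (congrFun hv i)
  rwa [hv', Subsingleton.elim xs default] at hr

theorem FirstOrder.Language.BoundedFormula.IsUniversal.not_definesValuationRings {K : Type u}
    [Field K] {O : ValuationSubring K} (hO : O ≠ ⊤) {φ : Language.ring.Formula (Fin 1)}
    (hφ : φ.IsUniversal) : ¬ DefinesValuationRings O φ := fun h => by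
  refine not_forall_algebraMap_mem_definedSet_iff (A := AlgebraicClosure K) hO φ fun x =>
    ⟨fun hx => (h.algebraMap_mem_definedSet_iff K x).1
      (hφ.mem_definedSet_of_map (algebraMap K (AlgebraicClosure K)).injective hx), fun hx => ?_⟩
  by_contra hx'
  obtain ⟨F, _, v, xs, hv, -, hr⟩ := hφ.exists_finiteDimensional_not_realize (K := K) _ _ hx'
  have hv' : v = fun _ => algebraMap K F x := funext fun i => Subtype.ext (congrFun hv i)
  rw [hv', Subsingleton.elim xs default] at hr
  exact hr ((h.algebraMap_mem_definedSet_iff F x).2 hx)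

/-- Here `(K, O)` is a Henselian valued field: `O` is a nontrivial valuation ring of `K` that
satisfies Hensel's lemma. -/
theorem theorem1p4 {K : Type u} [Field K] (O : ValuationSubring K) (hO : O ≠ ⊤)
    [HenselianLocalRing O] :
    (¬ ∃ ψ : Language.ring.Formula (Fin 1), ψ.IsExistential ∧ DefinesValuationRings O ψ) ∧
    (¬ ∃ η : Language.ring.Formula (Fin 1), η.IsUniversal ∧ DefinesValuationRings O η) :=
  ⟨fun ⟨_, hψ, h⟩ => hψ.not_definesValuationRings hO h,
    fun ⟨_, hη, h⟩ => hη.not_definesValuationRings hO h⟩
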